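/- **Definitions.** A signature is a set of operation symbols with finite arities; an algebra $\mathbf A$ of a signature $\Sigma$ is a set $A$ with an operation $f^{\mathbf A}:A^{n}\to A$ for each $n$-ary $f\in\Sigma$. An *equational condition* $\mathcal S$ is a (possibly infinite) system of equations $s\approx t$ between terms in some signature $\Delta$, where $\Delta$ consists of the operation symbols of the condition. An algebra $\mathbf A$ of an arbitrary signature $\Sigma$ *satisfies* $\mathcal S$ if each $n$-ary symbol of $\Delta$ can be replaced by an $n$-ary term in the signature $\Sigma$ so that all the resulting equations hold in $\mathbf A$. The condition $\mathcal S$ is *trivial* if every algebra satisfies it; it is *idempotent* if, for each $f\in\Delta$, the equation $f(x,x,\dots,x)\approx x$ is a consequence of $\mathcal S$, that is, holds in every algebra of signature $\Delta$ in which all the equations of $\mathcal S$ hold. **Theorem 1.1.** For every algebra $\mathbf A$ the following are equivalent: 1. $\mathbf A$ satisfies some nontrivial idempotent equational condition; 2. $\mathbf A$ has a $6$-ary term $t$ that is idempotent, i.e. $t(x,x,x,x,x,x)\approx x$ holds in $\mathbf A$, and satisfies in $\mathbf A$ the equations $$t(x,y,y,y,x,x)\;\approx\; t(y,x,y,x,y,x)\;\approx\;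 t(y,y,x,x,x,y).$$ Consequently the equational condition $\mathcal W$ (the weak $3$-cube condition), in one $6$-ary symbol $t$ with the equations $t(x,x,x,x,x,x)\approx x$ and $t(x,y,y,y,x,x)\approx t(y,x,y,x,y,x)\approx t(y,y,x,x,x,y)$, is the weakest nontrivial idempotent equational condition: $\mathcal W$ is itself nontrivial and idempotent, and for every nontrivial idempotent equational condition $\mathcal S$, every algebra that satisfies $\mathcal S$ satisfies $\mathcal W$. -/

import Mathlib

universe d u v w

/-- The algebra `A` (an `L`-structure, where `L` has no relation symbols) satisfies the equation
`s ≈ t`: the two terms agree under every evaluation of the variables in `A`. -/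
def SatisfiesEquation {L : FirstOrder.Language.{u, v}} (A : Type w) [L.Structure A] {α : Type}
    (s t : L.Term α) : Prop :=
  ∀ e : α → A, s.realize e = t.realize e

/-- An equational condition: a system of equations in some purely algebraic signature.
The signature is understood to consist of the operation symbols of the condition. The system may be
infinite; every single equation involves only finitely many variables, so that a countable supply of
variables suffices. -/
structure EquationalCondition : Type (d + 1) where
  /-- The operation symbols, graded by their arity. -/
  signature : FirstOrder.Language.{d, 0}
  /-- There are no relation symbols. -/
  isAlgebraic : signature.IsAlgebraic
  /-- The equations `s ≈ t`, as pairs of terms. -/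
  equations : Set (signature.Term ℕ × signature.Term ℕ)

namespace EquationalCondition

/-- An algebra `A` of a signature `L` satisfies the condition `S` if all equations of `S` hold in `A`
after replacing each `n`-ary operation symbol of `S` by a suitable `n`-ary term of `L`. -/
def SatisfiedBy (S : EquationalCondition.{d}) (L : FirstOrder.Language.{u, v}) (A : Type w)
    [L.Structure A] : Prop :=
  ∃ c : ∀ {n : ℕ}, S.signature.Functions n → L.Term (Fin n),
    ∀ p ∈ S.equations, SatisfiesEquation A (p.1.substFunc c) (p.2.substFunc c)

/-- The equation `s ≈ t` in the signature of `S` is a consequence of the equations of `S`: it holds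
in every algebra of that signature in which all equations of `S` hold. The universe is that of the
terms, so it contains the free algebras modulo `S` on countably many generators. -/
def Implies (S : EquationalCondition.{d}) (s t : S.signature.Term ℕ) : Prop :=
  ∀ (B : Type d) [S.signature.Structure B],
    (∀ p ∈ S.equations, SatisfiesEquation B p.1 p.2) → SatisfiesEquation B s t

/-- `S` is idempotent: for every operation symbol `f`, the equation `f(x, x, …, x) ≈ x` is a
consequence of the equations of `S`. -/
def IsIdempotent (S : EquationalCondition.{d}) : Prop :=
  ∀ {n : ℕ} (f : S.signature.Functions n),
    S.Implies (FirstOrder.Language.Term.func f fun _ => FirstOrder.Language.Term.var 0) (FirstOrder.Language.Term.var 0)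

/-- `S` is trivial: it is satisfied in every algebra (of every signature). -/
def IsTrivial (S : EquationalCondition.{d}) : Prop :=
  ∀ (L : FirstOrder.Language.{u, v}) [L.IsAlgebraic] (A : Type w) [L.Structure A], S.SatisfiedBy L A

/-- `S` is weaker than (or of the same strength as) `T`: every algebra that satisfies `T` also
satisfies `S`. -/
def WeakerThan (S T : EquationalCondition.{d}) : Prop :=
  ∀ (L : FirstOrder.Language.{u, v}) [L.IsAlgebraic] (A : Type w) [L.Structure A],
    T.SatisfiedBy L A → S.SatisfiedBy L A

end EquationalCondition

/-- A single operation symbol, of arity six. -/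
inductive SixarySymbol : ℕ → Type d
  | t : SixarySymbol 6

/-- The signature with a single operation symbol `t` of arity six. -/
def sixarySignature : FirstOrder.Language.{d, 0} := ⟨SixarySymbol, fun _ => Empty⟩

/-- The term `t(x_{i 0}, …, x_{i 5})` in the variables `x_0, x_1, …`. -/
def sixaryTerm (i : Fin 6 → ℕ) : sixarySignature.{d}.Term ℕ :=
  FirstOrder.Language.Term.func (L := sixarySignature) (l := 6) SixarySymbol.t
    fun k => FirstOrder.Language.Term.var (i k)

/-- The weak 3-cube condition: `t(x,x,x,x,x,x) ≈ x` and
`t(x,y,y,y,x,x) ≈ t(y,x,y,x,y,x) ≈ t(y,y,x,x,x,y)`, with the variables `x = x_0` and `y = x_1`. -/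
def weakThreeCube : EquationalCondition.{d} where
  signature := sixarySignature
  isAlgebraic := fun _ => inferInstanceAs (IsEmpty Empty)
  equations :=
    {(sixaryTerm ![0, 0, 0, 0, 0, 0], FirstOrder.Language.Term.var 0),
     (sixaryTerm ![0, 1, 1, 1, 0, 0], sixaryTerm ![1, 0, 1, 0, 1, 0]),
     (sixaryTerm ![1, 0, 1, 0, 1, 0], sixaryTerm ![1, 1, 0, 0, 0, 1])}

/-! Projections satisfy only trivial conditions, so the equations of a nontrivial condition fail
under every assignment of a projection to each symbol; by compactness finitely many of them suffice
for this (`exists_finite_of_not_proj`). In an idempotent algebra satisfying them, composing basic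
operations along a long enough list of symbols gives one Taylor operation `t`: for each of its
variables there is an identity in two letters whose sides carry different letters at that variable
(`exists_taylor`).

A weak 3-cube term amounts to a constant triple in the relation on binary term operations generated
by the six nonconstant triples over `{x, y}`. The properties collected in `NonconstantRelation`,
with the Taylor identities, already force such a triple (`exists_constant`). It is `t` of elements
`n j = t (D below j, q j at j, U above j)`, where `D` and `U` are recursive and `q j` comes from the
identity at `j` (`exists_branch`). -/

/-! ### Constant triples from a Taylor operation -/

/-- A ternary relation `R` on an algebra `B` with one idempotent operation `t`, modelled on the
relation generated by the nonconstant triples over `{x, y}`: it is symmetric, closed under `t`, contains every triple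
with entries `x` and `y`, and every triple with an entry and its image under the swap `st` of `x`
and `y`. -/
structure NonconstantRelation {B I : Type*} (t : (I → B) → B) (st : B → B) (x y : B)
    (R : B → B → B → Prop) : Prop where
  swap₁₂ : ∀ {a b c}, R a b c → R b a c
  swap₂₃ : ∀ {a b c}, R a b c → R a c b
  closed : ∀ {φ ψ χ : I → B}, (∀ i, R (φ i) (ψ i) (χ i)) → R (t φ) (t ψ) (t χ)
  idem : ∀ b, t (fun _ => b) = b
  of_generators : ∀ c, R x y c
  of_swap : ∀ c d, R (st c) c d

/-- `branch i lo hi z` is `z` at `i`, `lo` below `i` and `hi` above `i`. -/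
def branch {B I : Type*} [LinearOrder I] (i : I) (lo hi z : B) (k : I) : B :=
  if k < i then lo else if i < k then hi else z

section branch

variable {B I : Type*} [LinearOrder I] {i k : I} {lo hi z : B}

theorem branch_lt (h : k < i) : branch i lo hi z k = lo := if_pos h

theorem branch_gt (h : i < k) : branch i lo hi z k = hi := by simp [branch, h, h.not_gt]

theorem branch_self : branch i lo hi z i = z := by simp [branch]

end branch

namespace NonconstantRelation

variable {B I : Type*} {t : (I → B) → B} {st : B → B} {x y : B} {R : B → B → B → Prop}

theorem rotate (h : NonconstantRelation t st x y R) {a b c : B} (hr : R a b c) : R b c a :=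
  h.swap₂₃ (h.swap₁₂ hr)

theorem reverse (h : NonconstantRelation t st x y R) {a b c : B} (hr : R a b c) : R c b a :=
  h.swap₁₂ (h.rotate hr)

theorem of_generators' (h : NonconstantRelation t st x y R) (c : B) : R y x c :=
  h.swap₁₂ (h.of_generators c)

theorem closed₁₂ (h : NonconstantRelation t st x y R) {φ ψ : I → B} {c : B}
    (hr : ∀ i, R (φ i) (ψ i) c) : R (t φ) (t ψ) c := by
  have := h.closed (χ := fun _ => c) hr
  rwa [h.idem] at this

theorem closed₁ (h : NonconstantRelation t st x y R) {φ : I → B} {b c : B}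
    (hr : ∀ i, R (φ i) b c) : R (t φ) b c := by
  have := h.closed₁₂ (ψ := fun _ => b) hr
  rwa [h.idem] at this

theorem closed₂₃ (h : NonconstantRelation t st x y R) {ψ χ : I → B} {a : B}
    (hr : ∀ i, R a (ψ i) (χ i)) : R a (t ψ) (t χ) :=
  h.rotate (h.rotate (h.closed₁₂ fun i => h.rotate (hr i)))

/-- If `t` takes the same value at the tuples `u` and `v` over `{x, y}`, and `w` is opposite to them
wherever they agree, then two copies of this value are related to `t w`. -/
theorem of_eq (h : NonconstantRelation t st x y R) {u v : I → Bool} {w : I → B}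
    (huv : t (fun k => if u k then x else y) = t (fun k => if v k then x else y))
    (hw : ∀ k, u k = v k → w k = if u k then y else x) :
    R (t fun k => if u k then x else y) (t fun k => if u k then x else y) (t w) := by
  nth_rewrite 2 [huv]
  refine h.closed fun k => ?_
  have hk := hw k
  cases hu : u k <;> cases hv : v k <;> simp only [hu, hv] at hk ⊢
  · simpa [hk] using h.swap₂₃ (h.of_generators' y)
  · exact h.of_generators' _
  · exact h.of_generators _
  · simpa [hk] using h.swap₂₃ (h.of_generators x)

variable [LinearOrder I]

/-- Away from `i` the first two entries are `x` and `y` in some order, so the third is free there;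
only the triple at `i` has to be supplied. -/
theorem branch_closed (h : NonconstantRelation t st x y R) {i : I} {z z' : B} {w : I → B}
    (hr : R z z' (w i)) : R (t (branch i x y z)) (t (branch i y x z')) (t w) := by
  refine h.closed fun k => ?_
  rcases lt_trichotomy k i with hk | rfl | hk
  · simpa only [branch_lt hk] using h.of_generators _
  · simpa only [branch_self] using hr
  · simpa only [branch_gt hk] using h.of_generators' _

theorem branch_closed₁₂ (h : NonconstantRelation t st x y R) {i : I} {z z' c : B}
    (hr : R z z' c) : R (t (branch i x y z)) (t (branch i y x z')) c := by
  have := h.branch_closed (i := i) (w := fun _ => c) hr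
  rwa [h.idem] at this

/-- The end of a chain of nested branches at `i`, through which three copies of a branch operation are
separated as long as the letter `i` is repeated. -/
theorem exists_branch (h : NonconstantRelation t st x y R) {i : I}
    (ht : ∃ u v : I → Bool, u i ≠ v i ∧
      t (fun k => if u k then x else y) = t (fun k => if v k then x else y)) :
    ∃ z, ∀ w : I → B, w i = t (branch i x y z) → R z (t (branch i x y z)) (t w) := by
  obtain ⟨u, v, hne, huv⟩ := ht
  let p₉ := t fun k => if u k then x else y
  let p₈ := t (branch i y x p₉)
  let p₇ := t (branch i x y p₈)
  -- `u` and `v` differ at `i`, so the entry there is free in `of_eq`; choosing `p₇` is what lets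
  -- the later triples with third entry `p₆` go through.
  let w₆ : I → B := fun k => if u k = v k then (if u k then y else x) else p₇
  let p₆ := t w₆
  let p₅ := t (branch i x y p₆)
  let p₄ := t (branch i y x p₅)
  let p₃ := t (branch i y x p₄)
  let p₂ := t (branch i x y p₃)
  have hw₆ : w₆ i = p₇ := if_neg hne
  have h₉₉₆ : R p₉ p₉ p₆ := h.of_eq huv fun k hk => if_pos hk
  have h₅₈₉ : R p₅ p₈ p₉ := h.branch_closed₁₂ (h.reverse h₉₉₆)
  have h₇₈₅ : R p₇ p₈ p₅ := h.branch_closed₁₂ (h.rotate h₅₈₉)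
  have h₇₄₆ : R p₇ p₄ p₆ := h.branch_closed (by rw [hw₆]; exact h.rotate h₇₈₅)
  have h₅₃₆ : R p₅ p₃ p₆ := h.branch_closed (by rw [hw₆]; exact h.reverse h₇₄₆)
  have h₅₄₃ : R p₅ p₄ p₃ := h.branch_closed₁₂ (h.swap₁₂ (h.swap₂₃ h₅₃₆))
  have h₂₃₄ : R p₂ p₃ p₄ := h.branch_closed (by rw [branch_self]; exact h.reverse h₅₄₃)
  refine ⟨p₃, fun w hw => h.swap₁₂ (h.branch_closed ?_)⟩
  rw [hw]
  exact h.rotate h₂₃₄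

/-- An idempotent operation satisfying, for each of its variables, an equation
between `x` and `y` that is nontrivial at this variable forces a constant triple. -/
theorem exists_constant [Finite I] (h : NonconstantRelation t st x y R)
    (ht : ∀ i, ∃ u v : I → Bool, u i ≠ v i ∧
      t (fun k => if u k then x else y) = t (fun k => if v k then x else y)) :
    ∃ r, R r r r := by
  choose z hz using fun i => h.exists_branch (ht i)
  let q : I → B := fun i => t (branch i x y (z i))
  -- `U j` is `t` of the swaps of the entries `w j k` below for `k ≥ j`, with `x` at `k < j`; dually
  -- `D j` swaps the entries for `k ≤ j` and has `y` at `k > j`. Thus `of_swap` handles one side of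
  -- `j` and `hx` or `hy` the other.
  obtain ⟨U, hU⟩ : ∃ U : I → B, ∀ j, U j = t fun k =>
      if j < k then st (U k) else if k < j then x else st (q j) :=
    ⟨(wellFounded_gt (α := I)).fix fun j U => t fun k =>
      if hk : j < k then st (U k hk) else if k < j then x else st (q j), fun j => by
        rw [WellFounded.fix_eq]; simp only [dite_eq_ite]⟩
  obtain ⟨D, hD⟩ : ∃ D : I → B, ∀ j, D j = t fun k =>
      if k < j then st (D k) else if j < k then y else st (q j) :=
    ⟨(wellFounded_lt (α := I)).fix fun j D => t fun k =>
      if hk : k < j then st (D k hk) else if j < k then y else st (q j), fun j => by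
        rw [WellFounded.fix_eq]; simp only [dite_eq_ite]⟩
  let w : I → I → B := fun j k => if k < j then D k else if j < k then U k else q j
  let n : I → B := fun j => t (w j)
  have hw_lt : ∀ {j k}, k < j → w j k = D k := fun hk => if_pos hk
  have hw_gt : ∀ {j k}, j < k → w j k = U k := fun hk => by simp [w, hk, hk.not_gt]
  have hw_self : ∀ j, w j j = q j := fun j => by simp [w]
  have hy : ∀ k, R y (U k) (n k) := fun k => by
    rw [hU]
    refine h.closed₂₃ fun l => ?_
    rcases lt_trichotomy l k with hl | rfl | hl
    · simpa only [hl, hl.not_gt, if_true, if_false] using h.of_generators' _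
    · simpa only [lt_irrefl, if_false, hw_self] using h.rotate (h.rotate (h.of_swap _ _))
    · simpa only [hl, if_true, hw_gt hl] using h.rotate (h.rotate (h.of_swap _ _))
  have hx : ∀ k, R x (D k) (n k) := fun k => by
    rw [hD]
    refine h.closed₂₃ fun l => ?_
    rcases lt_trichotomy l k with hl | rfl | hl
    · simpa only [hl, if_true, hw_lt hl] using h.rotate (h.rotate (h.of_swap _ _))
    · simpa only [lt_irrefl, if_false, hw_self] using h.rotate (h.rotate (h.of_swap _ _))
    · simpa only [hl, hl.not_gt, if_true, if_false] using h.of_generators _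
  -- The first entry is reduced to `n i = t (w i)`, then the first two are expanded together to `w i
  -- j` and `n j`. The third entry `t n` is kept whole and expanded over `k` in each case.
  refine ⟨t n, h.closed₁ fun i => h.closed₁₂ fun j => ?_⟩
  rcases lt_trichotomy i j with hij | rfl | hij
  · rw [hw_gt hij, hU]
    refine h.closed fun k => ?_
    rcases lt_trichotomy k j with hk | rfl | hk
    · simpa only [hk, hk.not_gt, if_true, if_false, hw_lt hk] using hx k
    · simpa only [lt_irrefl, if_false, hw_self] using h.of_swap _ _
    · simpa only [hk, if_true, hw_gt hk] using h.of_swap _ _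
  · rw [hw_self]
    refine h.closed fun k => ?_
    rcases lt_trichotomy k i with hk | rfl | hk
    · simpa only [branch_lt hk, hw_lt hk] using hx k
    -- The only place where the Taylor identity is used: neither swaps nor generators cover the
    -- diagonal position.
    · simpa only [branch_self, hw_self] using hz k (w k) (hw_self k)
    · simpa only [branch_gt hk, hw_gt hk] using hy k
  · rw [hw_lt hij, hD]
    refine h.closed fun k => ?_
    rcases lt_trichotomy k j with hk | rfl | hk
    · simpa only [hk, if_true, hw_lt hk] using h.of_swap _ _
    · simpa only [lt_irrefl, if_false, hw_self] using h.of_swap _ _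
    · simpa only [hk, hk.not_gt, if_true, if_false, hw_gt hk] using hy k

end NonconstantRelation

open FirstOrder.Language

/-! ### Taylor operations from equations that fail for projections -/

namespace IteratedOperation

variable {L : FirstOrder.Language.{u, v}}

/-- The indices of the variables of the iterated composition `f₁(f₂(⋯), …, f₂(⋯))` of a list of
operation symbols: an argument position for each entry of the list. -/
def Index : List (Σ n, L.Functions n) → Type
  | [] => Unit
  | f :: l => Fin f.1 × Index l

instance (l : List (Σ n, L.Functions n)) : Finite (Index l) := by
  induction l with
  | nil => exact inferInstanceAs (Finite Unit)
  | cons f l ih => exact inferInstanceAs (Finite (Fin f.1 × Index l))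

/-- The iterated composition of a list of operations, with variables indexed by `Index l`. -/
def comp {A : Type w} [L.Structure A] : (l : List (Σ n, L.Functions n)) → (Index l → A) → A
  | [], φ => φ ()
  | f :: l, φ => FirstOrder.Language.Structure.funMap f.2 fun c => comp l fun a => φ (c, a)

/-- The iterated composition of a list of operation symbols, applied to terms. -/
def compTerm {α : Type} : (l : List (Σ n, L.Functions n)) → (Index l → L.Term α) → L.Term α
  | [], φ => φ ()
  | f :: l, φ => Term.func f.2 fun c => compTerm l fun a => φ (c, a)

theorem realize_compTerm {A : Type w} [L.Structure A] {α : Type} (e : α → A) :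
    ∀ (l : List (Σ n, L.Functions n)) (φ : Index l → L.Term α),
      (compTerm l φ).realize e = comp l fun a => (φ a).realize e
  | [], _ => rfl
  | f :: l, φ => by
    simp only [compTerm, comp, Term.realize_func]
    congr 1
    funext c
    exact realize_compTerm e l _

/-- All operations of `A` are idempotent. -/
def Idempotent (L : FirstOrder.Language.{u, v}) (A : Type w) [L.Structure A] : Prop :=
  ∀ {n : ℕ} (f : L.Functions n) (a : A),
    FirstOrder.Language.Structure.funMap f (fun _ => a) = a

section

variable {A : Type w} [L.Structure A]

theorem Idempotent.realize (h : Idempotent L A) {α : Type*} (s : L.Term α) (a : A) :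
    s.realize (fun _ => a) = a := by
  induction s with
  | var => rfl
  | func f ts ih => simp only [Term.realize_func, ih, h f a]

theorem Idempotent.comp (h : Idempotent L A) (l : List (Σ n, L.Functions n)) (a : A) :
    comp l (fun _ => a) = a := by
  induction l with
  | nil => rfl
  | cons f l ih => simp only [IteratedOperation.comp, ih, h f.2 a]

end

/-- The value of a term when each operation symbol is interpreted as a projection. -/
def proj {α : Type*} (π : ∀ f : Σ n, L.Functions n, Fin f.1) : L.Term α → α
  | .var x => x
  | .func f ts => proj π (ts (π ⟨_, f⟩))

open Classical in
/-- Passes from a term with outermost symbol `f` to its argument at position `c`, and leaves any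
other term unchanged. -/
noncomputable def descend {α : Type*} (f : Σ n, L.Functions n) (c : Fin f.1) :
    L.Term α → L.Term α
  | .var x => .var x
  | .func g ts => if h : f = ⟨_, g⟩ then ts (Fin.cast (congrArg Sigma.fst h) c) else .func g ts

/-- Descends in a term along a list of operation symbols with given argument positions. -/
noncomputable def descendList {α : Type*} :
    (l : List (Σ n, L.Functions n)) → Index l → L.Term α → L.Term α
  | [], _, s => s
  | f :: l, a, s => descendList l a.2 (descend f a.1 s)

theorem descendList_var {α : Type*} (l : List (Σ n, L.Functions n)) (a : Index l) (x : α) :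
    descendList l a (.var x : L.Term α) = .var x := by
  induction l with
  | nil => rfl
  | cons f l ih => exact ih a.2

/-- When the outermost symbol matches the list entry, the composition rebuilds the term from its
arguments; otherwise all arguments are the same and idempotence removes the entry. -/
theorem comp_descendList {A : Type w} [L.Structure A] (h : Idempotent L A) {α : Type*} (e : α → A)
    (l : List (Σ n, L.Functions n)) (s : L.Term α) :
    (comp l fun a => (descendList l a s).realize e) = s.realize e := by
  induction l generalizing s with
  | nil => rfl
  | cons f l ih =>
    simp only [comp, descendList, ih]
    cases s with
    | var x => exact h f.2 _
    | func g ts =>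
      by_cases hfg : f = ⟨_, g⟩
      · subst hfg
        simp [descend]
      · simp only [descend, hfg, dite_false]
        exact h f.2 _

/-- The index `a` follows the projections `π`. -/
def Follows (π : ∀ f : Σ n, L.Functions n, Fin f.1) :
    (l : List (Σ n, L.Functions n)) → Index l → Prop
  | [], _ => True
  | f :: l, a => a.1 = π f ∧ Follows π l a.2

theorem proj_descend {α : Type*} (π : ∀ f : Σ n, L.Functions n, Fin f.1) (f : Σ n, L.Functions n)
    (s : L.Term α) : proj π (descend f (π f) s) = proj π s := by
  cases s with
  | var x => rfl
  | func g ts =>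
    by_cases hfg : f = ⟨_, g⟩
    · subst hfg
      simp [descend, proj]
    · simp [descend, hfg]

theorem proj_descendList {α : Type*} {π : ∀ f : Σ n, L.Functions n, Fin f.1}
    {l : List (Σ n, L.Functions n)} {a : Index l} (h : Follows π l a) (s : L.Term α) :
    proj π (descendList l a s) = proj π s := by
  induction l generalizing s with
  | nil => rfl
  | cons f l ih => rw [descendList, ih h.2, h.1, proj_descend]

/-- Descending along sufficiently rich lists of operation symbols leads to the variables. -/
theorem exists_descendList_eq_var {α : Type*} (s : L.Term α) :
    ∃ l : List (Σ n, L.Functions n), ∀ l', l.Sublist l' → ∀ a : Index l',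
      ∃ x, descendList l' a s = .var x := by
  induction s with
  | var x => exact ⟨[], fun l' _ a => ⟨x, descendList_var l' a x⟩⟩
  | @func n g ts ih =>
    choose l hl using ih
    -- Once `g` is met, any of its arguments may be reached, so the lists of all arguments are
    -- appended. Extra symbols do no harm, hence the statement for all superlists.
    refine ⟨⟨n, g⟩ :: (List.ofFn l).flatten, fun l' hl' => ?_⟩
    induction l' with
    | nil => simp at hl'
    | cons f l' ih' =>
      intro a
      by_cases hfg : f = ⟨n, g⟩
      · subst hfg
        rw [List.cons_sublist_cons] at hl'
        simp only [descendList, descend, dite_true]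
        exact hl _ l' ((List.sublist_flatten_of_mem (by simp)).trans hl') a.2
      · have hl'' : (⟨n, g⟩ :: (List.ofFn l).flatten).Sublist l' := by
          rcases List.sublist_cons_iff.1 hl' with h | ⟨r, hr, -⟩
          · exact h
          · exact absurd (List.cons.inj hr).1.symm hfg
        simp only [descendList, descend, hfg, dite_false]
        exact ih' hl'' a.2

theorem exists_descendList_eq_var_of_finite {α : Type*} {s : Set (L.Term α)} (hs : s.Finite) :
    ∃ l : List (Σ n, L.Functions n), ∀ r ∈ s, ∀ a : Index l, ∃ x, descendList l a r = .var x := by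
  choose l hl using exists_descendList_eq_var (L := L) (α := α)
  refine ⟨(hs.toFinset.toList.map l).flatten, fun r hr => hl r _ (List.sublist_flatten_of_mem ?_)⟩
  exact List.mem_map.2 ⟨r, by simpa using hr, rfl⟩

section

variable {A : Type w} [L.Structure A]

/-- The operation of a symbol occurring in a list is obtained from the iterated composition by
identifying variables. -/
theorem exists_comp_eq_funMap (h : Idempotent L A) {π : ∀ f : Σ n, L.Functions n, Fin f.1}
    {f : Σ n, L.Functions n} {l : List (Σ n, L.Functions n)} (hf : f ∈ l) {a : Index l}
    (ha : Follows π l a) :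
    ∃ p : Index l → Fin f.1, p a = π f ∧ ∀ φ : Fin f.1 → A,
      comp l (fun b => φ (p b)) = FirstOrder.Language.Structure.funMap f.2 φ := by
  induction l with
  | nil => simp at hf
  | cons g l ih =>
    rcases List.mem_cons.1 hf with rfl | hf
    · exact ⟨Prod.fst, ha.1, fun φ => by simp only [comp, h.comp]⟩
    · obtain ⟨p, hp, hφ⟩ := ih hf ha.2
      refine ⟨fun b => p b.2, hp, fun φ => ?_⟩
      simp only [comp, hφ]
      exact h g.2 _

/-- The iterated composition satisfies an equation in two variables that is nontrivial at `a`. -/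
def TaylorAt (A : Type w) [L.Structure A] (l : List (Σ n, L.Functions n)) (a : Index l) : Prop :=
  ∃ u v : Index l → Bool, u a ≠ v a ∧ ∀ x y : A,
    comp l (fun b => if u b then x else y) = comp l (fun b => if v b then x else y)

theorem Follows.update [DecidableEq (Σ n, L.Functions n)] {π : ∀ f : Σ n, L.Functions n, Fin f.1}
    {f : Σ n, L.Functions n} {c : Fin f.1} {l : List (Σ n, L.Functions n)} (hf : f ∉ l)
    {a : Index l} (ha : Follows π l a) : Follows (Function.update π f c) l a := by
  induction l with
  | nil => trivial
  | cons g l ih =>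
    rw [List.mem_cons, not_or] at hf
    exact ⟨by rw [Function.update_of_ne (Ne.symm hf.1)]; exact ha.1, ih hf.2 ha.2⟩

/-- An index that follows no choice of projections takes two different positions at two occurrences
of one symbol `f`. Identifying variables according to either occurrence yields `f`, and equating the
two results gives an identity nontrivial at that index. -/
theorem exists_follows_or_taylorAt (h : Idempotent L A)
    (hne : Nonempty (∀ f : Σ n, L.Functions n, Fin f.1)) (l : List (Σ n, L.Functions n))
    (a : Index l) : (∃ π, Follows π l a) ∨ TaylorAt A l a := by
  classical
  induction l with
  | nil => exact .inl ⟨hne.some, trivial⟩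
  | cons f l ih =>
    obtain ⟨c, a⟩ := a
    rcases ih a with ⟨π, hπ⟩ | ⟨u, v, huv, heq⟩
    · by_cases hf : f ∈ l
      · by_cases hc : c = π f
        · exact .inl ⟨π, hc, hπ⟩
        · obtain ⟨p, hp, hφ⟩ := exists_comp_eq_funMap h hf hπ
          refine .inr ⟨fun b => decide (b.1 = c), fun b => decide (p b.2 = c), ?_, fun x y => ?_⟩
          · simp [hp, Ne.symm hc]
          · simp only [comp, decide_eq_true_eq, h.comp, hφ fun d => if d = c then x else y]
            exact (h f.2 _).symm
      · exact .inl ⟨Function.update π f c, by simp, hπ.update hf⟩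
    · exact .inr ⟨fun b => u b.2, fun b => v b.2, huv, fun x y => by simp only [comp, heq x y]⟩

/-- In the product topology over discrete factors, the projected variable depends continuously on
`π`, since evaluating it consults only finitely many symbols. -/
theorem isClosed_proj_eq {α : Type*} (s r : L.Term α) :
    IsClosed {π : ∀ f : Σ n, L.Functions n, Fin f.1 | proj π s = proj π r} := by
  let _ : TopologicalSpace α := ⊥
  have : DiscreteTopology α := ⟨rfl⟩
  have hc : ∀ s : L.Term α, Continuous fun π : ∀ f : Σ n, L.Functions n, Fin f.1 => proj π s := by
    intro s
    induction s with
    | var x => exact continuous_const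
    | @func n g ts ih =>
      have hF : Continuous fun p : Fin n × (∀ f : Σ n, L.Functions n, Fin f.1) =>
          proj p.2 (ts p.1) := continuous_prod_of_discrete_left.2 ih
      have hG : Continuous fun π : ∀ f : Σ n, L.Functions n, Fin f.1 => ((π ⟨n, g⟩ : Fin n), π) :=
        (continuous_apply (⟨n, g⟩ : Σ n, L.Functions n)).prodMk continuous_id
      exact hF.comp hG
  exact isClosed_eq (hc s) (hc r)

/-- Equations that are not satisfied by projections have a finite subsystem with this property. -/
theorem exists_finite_of_not_proj {α : Type*} {E : Set (L.Term α × L.Term α)}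
    (hE : ¬∃ π, ∀ p ∈ E, proj π p.1 = proj π p.2) :
    ∃ F ⊆ E, F.Finite ∧ ¬∃ π, ∀ p ∈ F, proj π p.1 = proj π p.2 := by
  obtain ⟨F, hF⟩ := isCompact_univ.elim_finite_subfamily_closed
    (fun p : E => {π : ∀ f : Σ n, L.Functions n, Fin f.1 | proj π p.1.1 = proj π p.1.2})
    (fun p => isClosed_proj_eq p.1.1 p.1.2) (by
      refine Set.eq_empty_iff_forall_notMem.2 fun π hπ => hE ⟨π, fun p hp => ?_⟩
      exact Set.mem_iInter.1 hπ.2 ⟨p, hp⟩)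
  refine ⟨Subtype.val '' (F : Set E), by simp, (F.finite_toSet.image _), fun ⟨π, hπ⟩ => ?_⟩
  refine Set.eq_empty_iff_forall_notMem.1 hF π ⟨trivial, Set.mem_iInter₂.2 fun p hp => ?_⟩
  exact hπ p.1 ⟨p, hp, rfl⟩

/-- An idempotent algebra satisfying equations that are not satisfied by projections has a Taylor
operation among the iterated compositions of its basic operations. -/
theorem exists_taylor (h : Idempotent L A) {α : Type} {E : Set (L.Term α × L.Term α)}
    (hA : ∀ p ∈ E, SatisfiesEquation A p.1 p.2)
    (hE : ¬∃ π, ∀ p ∈ E, proj π p.1 = proj π p.2) :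
    ∃ l : List (Σ n, L.Functions n), ∀ a, TaylorAt A l a := by
  classical
  by_cases hne : Nonempty (∀ f : Σ n, L.Functions n, Fin f.1)
  · obtain ⟨F, hFE, hfin, hF⟩ := exists_finite_of_not_proj hE
    obtain ⟨l, hl⟩ := exists_descendList_eq_var_of_finite
      ((hfin.image Prod.fst).union (hfin.image Prod.snd))
    refine ⟨l, fun a => (exists_follows_or_taylorAt h hne l a).elim (fun ⟨π, hπ⟩ => ?_) id⟩
    push Not at hF
    obtain ⟨p, hp, hne⟩ := hF π
    choose s hs using hl p.1 (.inl ⟨p, hp, rfl⟩)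
    choose r hr using hl p.2 (.inr ⟨p, hp, rfl⟩)
    have hsa : s a = proj π p.1 := by rw [← proj_descendList hπ, hs, proj]
    have hra : r a = proj π p.2 := by rw [← proj_descendList hπ, hr, proj]
    -- The equation failing under `π` becomes, after descent, an equation between tuples of
    -- variables that differ at `a`; the variable `s a` is sent to `x` and all others to `y`.
    refine ⟨fun b => decide (s b = s a), fun b => decide (r b = s a), ?_, fun x y => ?_⟩
    · simpa [hsa, hra] using hne.symm
    · have := hA p (hFE hp) fun z => if z = s a then x else y
      rw [← comp_descendList h _ l, ← comp_descendList h _ l] at this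
      simpa only [hs, hr, Term.realize_var, decide_eq_true_eq] using this
  -- Here some symbol is nullary, so its operation has no variables and the claim is vacuous.
  · rw [not_nonempty_iff, isEmpty_pi] at hne
    obtain ⟨f, hf⟩ := hne
    exact ⟨[f], fun a => hf.elim a.1⟩

end

end IteratedOperation

/-! ### Idempotent and trivial conditions -/

namespace EquationalCondition

open IteratedOperation

/-- Equivalence of terms modulo the identities of `A`. -/
def termSetoid (L : FirstOrder.Language.{u, v}) (A : Type w) [L.Structure A] :
    Setoid (L.Term ℕ) where
  r s t := SatisfiesEquation A s t
  iseqv := ⟨fun _ _ => rfl, fun h e => (h e).symm, fun h h' e => (h e).trans (h' e)⟩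

/-- Idempotence, tested in the universe of the terms, holds in every algebra. -/
theorem IsIdempotent.idempotent {S : EquationalCondition.{d}} (hS : S.IsIdempotent) {A : Type w}
    [S.signature.Structure A] (hA : ∀ p ∈ S.equations, SatisfiesEquation A p.1 p.2) :
    Idempotent S.signature A := by
  intro n f a
  -- The free algebra on countably many generators in the variety of `A` lies in the universe of the
  -- terms, even if `A` does not; its identities transfer back to `A`.
  let B : Type d := Quotient (termSetoid S.signature A)
  let _ : S.signature.Structure B :=
    { funMap := fun f xs => Quotient.mk _ (Term.func f fun i => (xs i).out)
      RelMap := fun _ _ => False }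
  have hout : ∀ (s : S.signature.Term ℕ) (e : ℕ → A),
      (Quotient.out (Quotient.mk (termSetoid S.signature A) s)).realize e = s.realize e :=
    fun s => Quotient.exact (Quotient.out_eq (Quotient.mk (termSetoid S.signature A) s))
  have hreal : ∀ (s : S.signature.Term ℕ) (e : ℕ → B),
      s.realize e = Quotient.mk (termSetoid S.signature A) (s.subst fun i => (e i).out) := by
    intro s e
    induction s with
    | var i => exact (Quotient.out_eq (e i)).symm
    | func g ts ih =>
      refine Quotient.sound fun e' => ?_
      simp only [Term.subst, Term.realize_func, ih, hout]
  have hB : ∀ p ∈ S.equations, SatisfiesEquation B p.1 p.2 := by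
    intro p hp e
    rw [hreal, hreal]
    refine Quotient.sound fun e' => ?_
    rw [Term.realize_subst, Term.realize_subst]
    exact hA p hp _
  have := hS f B hB fun _ => Quotient.mk (termSetoid S.signature A) (.var 0)
  rw [hreal, hreal] at this
  have := Quotient.exact this fun _ => a
  simpa only [Term.realize_subst, Term.realize_func, Term.realize_var, hout] using this

theorem isTrivial_of_proj {S : EquationalCondition.{d}} {π : ∀ f : Σ n, S.signature.Functions n, Fin f.1}
    (hπ : ∀ p ∈ S.equations, proj π p.1 = proj π p.2) :
    EquationalCondition.IsTrivial.{d, u, v, w} S := by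
  intro L _ A _
  refine ⟨fun {n} f => .var (π ⟨n, f⟩ : Fin n), fun p hp e => ?_⟩
  have : ∀ s : S.signature.Term ℕ,
      (s.substFunc fun {n} f => (.var (π ⟨n, f⟩ : Fin n) : L.Term (Fin n))).realize e =
        e (proj π s) := by
    intro s
    induction s with
    | var => rfl
    | func f ts ih =>
      simp only [Term.substFunc, Term.subst, proj]
      exact ih _
  rw [this, this, hπ p hp]

end EquationalCondition

/-! ### The relation generated by the nonconstant triples -/

section

open IteratedOperation

variable {L : FirstOrder.Language.{u, v}} (A : Type w) [L.Structure A]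

/-- The binary term operations of `A`, in the variables `true` and `false`. -/
def BinaryTermOperation (L : FirstOrder.Language.{u, v}) (A : Type w) [L.Structure A] : Type w :=
  {b : (Bool → A) → A // ∃ s : L.Term Bool, ∀ e, b e = s.realize e}

/-- The triples of binary term operations generated by the six nonconstant triples of variables. -/
def CubeRelation (p q r : BinaryTermOperation L A) : Prop :=
  ∃ s : L.Term (Fin 6), ∀ e : Bool → A,
    p.1 e = s.realize ![e true, e false, e false, e false, e true, e true] ∧
    q.1 e = s.realize ![e false, e true, e false, e true, e false, e true] ∧
    r.1 e = s.realize ![e false, e false, e true, e true, e true, e false]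

variable {A}

namespace BinaryTermOperation

/-- The projection to a variable. -/
def var (i : Bool) : BinaryTermOperation L A := ⟨fun e => e i, .var i, fun _ => rfl⟩

/-- The operation obtained by exchanging the two variables. -/
def swap (b : BinaryTermOperation L A) : BinaryTermOperation L A :=
  ⟨fun e => b.1 fun i => e !i, b.2.elim fun s hs => ⟨s.relabel (!·), fun e =>
    (hs _).trans (Term.realize_relabel (v := e)).symm⟩⟩

/-- The iterated composition of a list of operations, on binary term operations. -/
def comp (l : List (Σ n, L.Functions n)) (φ : Index l → BinaryTermOperation L A) :
    BinaryTermOperation L A :=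
  ⟨fun e => IteratedOperation.comp l fun a => (φ a).1 e, by
    choose s hs using fun a => (φ a).2
    exact ⟨compTerm l s, fun e => by simp only [realize_compTerm, hs]⟩⟩

/-- The symmetries permute the six generators. A triple `(x, y, c)` arises by applying the term of
`c` to `(x, y, x)` and `(x, y, y)`, idempotence fixing the first two entries. Applying the term of
`c` to `(y, x, d)` and `(x, y, d)` then gives `(swap c, c, d)`. -/
theorem nonconstantRelation (h : Idempotent L A) (l : List (Σ n, L.Functions n)) :
    NonconstantRelation (comp (A := A) l) swap (var true) (var false) (CubeRelation A) where
  swap₁₂ := by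
    rintro a b c ⟨s, hs⟩
    refine ⟨s.relabel ![1, 0, 2, 4, 3, 5], fun e => ?_⟩
    obtain ⟨h₁, h₂, h₃⟩ := hs e
    simp only [Term.realize_relabel, h₁, h₂, h₃]
    refine ⟨?_, ?_, ?_⟩ <;> congr 1 <;> ext i <;> fin_cases i <;> rfl
  swap₂₃ := by
    rintro a b c ⟨s, hs⟩
    refine ⟨s.relabel ![0, 2, 1, 3, 5, 4], fun e => ?_⟩
    obtain ⟨h₁, h₂, h₃⟩ := hs e
    simp only [Term.realize_relabel, h₁, h₂, h₃]
    refine ⟨?_, ?_, ?_⟩ <;> congr 1 <;> ext i <;> fin_cases i <;> rfl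
  closed := by
    intro φ ψ χ hr
    choose s hs using hr
    refine ⟨compTerm l s, fun e => ?_⟩
    simp only [realize_compTerm, comp]
    refine ⟨?_, ?_, ?_⟩ <;> congr 1 <;> funext a
    exacts [(hs a e).1, (hs a e).2.1, (hs a e).2.2]
  idem b := Subtype.ext (funext fun e => h.comp l (b.1 e))
  of_generators c := by
    obtain ⟨s, hs⟩ := c.2
    refine ⟨s.relabel fun i => if i then 4 else 0, fun e => ?_⟩
    simp only [Term.realize_relabel, hs]
    refine ⟨(h.realize s (e true)).symm.trans ?_, (h.realize s (e false)).symm.trans ?_, ?_⟩ <;>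
      congr 1 <;> ext i <;> cases i <;> rfl
  of_swap c d := by
    obtain ⟨s, hs⟩ := c.2
    obtain ⟨r, hr⟩ := d.2
    refine ⟨s.subst fun i => if i then r.relabel fun j => if j then 3 else 1
      else r.relabel fun j => if j then 4 else 0, fun e => ?_⟩
    simp only [Term.realize_subst, swap, hs, hr]
    refine ⟨?_, ?_, (h.realize s _).symm.trans ?_⟩ <;>
      congr 1 <;> ext i <;> cases i <;>
      simp only [if_true, if_false, Term.realize_relabel, Bool.false_eq_true, Bool.not_true, Bool.not_false]
    · exact (h.realize r _).symm.trans (by congr 1; ext j; cases j <;> rfl)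
    · exact (h.realize r _).symm.trans (by congr 1; ext j; cases j <;> rfl)
    · exact (h.realize r _).symm.trans (by congr 1; ext j; cases j <;> rfl)
    · exact (h.realize r _).symm.trans (by congr 1; ext j; cases j <;> rfl)
    · congr 1; ext j; cases j <;> rfl
    · congr 1; ext j; cases j <;> rfl

end BinaryTermOperation

/-- An idempotent algebra satisfying equations that are not satisfied by projections has a weak
3-cube term. -/
theorem exists_weakThreeCube_term (h : Idempotent L A) {α : Type}
    {E : Set (L.Term α × L.Term α)} (hA : ∀ p ∈ E, SatisfiesEquation A p.1 p.2)
    (hE : ¬∃ π, ∀ p ∈ E, proj π p.1 = proj π p.2) :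
    ∃ s : L.Term (Fin 6), ∀ x y : A,
      s.realize ![x, y, y, y, x, x] = s.realize ![y, x, y, x, y, x] ∧
      s.realize ![y, x, y, x, y, x] = s.realize ![y, y, x, x, x, y] := by
  obtain ⟨l, hl⟩ := exists_taylor h hA hE
  classical
  -- Any linear order serves; the index set is finite, so recursion works in both directions.
  let _ : LinearOrder (Index l) := linearOrderOfSTO WellOrderingRel
  obtain ⟨r, s, hs⟩ := (BinaryTermOperation.nonconstantRelation h l).exists_constant fun a => by
    obtain ⟨u, v, hne, huv⟩ := hl a
    have hval : ∀ (u : Index l → Bool) (e : Bool → A),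
        (BinaryTermOperation.comp l fun k => if u k then BinaryTermOperation.var true
          else BinaryTermOperation.var (A := A) false).1 e =
        comp l fun k => if u k then e true else e false := fun u e => by
      refine congrArg (comp l) (funext fun k => ?_)
      cases hu : u k <;> simp [hu, BinaryTermOperation.var]
    refine ⟨u, v, hne, Subtype.ext (funext fun e => ?_)⟩
    rw [hval, hval, huv]
  refine ⟨s, fun x y => ?_⟩
  obtain ⟨h₁, h₂, h₃⟩ := hs fun i => if i then x else y
  exact ⟨h₁.symm.trans h₂, h₂.symm.trans h₃⟩

end

/-! ### The weak 3-cube condition and the main theorem -/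

theorem EquationalCondition.SatisfiedBy.exists_weakThreeCube_term {S : EquationalCondition.{d}}
    (hS : ¬ EquationalCondition.IsTrivial.{d, u, v, w} S) (hidem : S.IsIdempotent)
    {L : FirstOrder.Language.{u, v}} {A : Type w} [L.Structure A] (h : S.SatisfiedBy L A) :
    ∃ t : L.Term (Fin 6),
      (∀ x : A, t.realize ![x, x, x, x, x, x] = x) ∧
      ∀ x y : A,
        t.realize ![x, y, y, y, x, x] = t.realize ![y, x, y, x, y, x] ∧
        t.realize ![y, x, y, x, y, x] = t.realize ![y, y, x, x, x, y] := by
  obtain ⟨c, hc⟩ := h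
  -- `A` becomes an algebra in the signature of `S` through the chosen terms; the resulting 6-ary
  -- term is translated back by `substFunc`.
  let _ : S.signature.Structure A :=
    { funMap := fun f xs => (c f).realize xs
      RelMap := fun _ _ => False }
  have hreal : ∀ {α : Type} (s : S.signature.Term α) (e : α → A),
      (s.substFunc c).realize e = s.realize e :=
    fun s e => Term.realize_substFunc (c := c) (fun _ _ => rfl) e s
  have hA : ∀ p ∈ S.equations, SatisfiesEquation A p.1 p.2 := fun p hp e => by
    rw [← hreal, ← hreal]; exact hc p hp e
  have hA' : IteratedOperation.Idempotent S.signature A := hidem.idempotent hA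
  obtain ⟨s, hs⟩ := _root_.exists_weakThreeCube_term hA' hA
    fun ⟨π, hπ⟩ => hS (EquationalCondition.isTrivial_of_proj hπ)
  refine ⟨s.substFunc c, fun x => ?_, fun x y => ?_⟩
  · rw [hreal]
    refine Eq.trans ?_ (hA'.realize s x)
    congr 1; ext i; fin_cases i <;> rfl
  · simpa only [hreal] using hs x y

theorem apply_vecSix {A : Type*} (e : ℕ → A) (a b c d f g : ℕ) :
    (fun k => e (![a, b, c, d, f, g] k)) = ![e a, e b, e c, e d, e f, e g] := by
  ext k
  fin_cases k <;> rfl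

theorem weakThreeCube_satisfiedBy {L : FirstOrder.Language.{u, v}} {A : Type w} [L.Structure A]
    (t : L.Term (Fin 6)) (ht : ∀ x : A, t.realize ![x, x, x, x, x, x] = x)
    (ht' : ∀ x y : A,
      t.realize ![x, y, y, y, x, x] = t.realize ![y, x, y, x, y, x] ∧
      t.realize ![y, x, y, x, y, x] = t.realize ![y, y, x, x, x, y]) :
    weakThreeCube.{d}.SatisfiedBy L A := by
  have hreal : ∀ (i : Fin 6 → ℕ) (e : ℕ → A),
      ((sixaryTerm.{d} i).substFunc fun {n} f =>
        (SixarySymbol.rec (motive := fun n _ => L.Term (Fin n)) t f : L.Term (Fin n))).realize e =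
        t.realize fun k => e (i k) :=
    fun i e => Term.realize_subst
  refine ⟨fun {n} f => SixarySymbol.rec (motive := fun n _ => L.Term (Fin n)) t f, ?_⟩
  rintro p (rfl | rfl | rfl) e
  · exact (hreal _ e).trans (by rw [apply_vecSix]; exact ht _)
  · exact (hreal _ e).trans (Eq.trans (by rw [apply_vecSix, apply_vecSix]; exact (ht' _ _).1) (hreal _ e).symm)
  · exact (hreal _ e).trans (Eq.trans (by rw [apply_vecSix, apply_vecSix]; exact (ht' _ _).2) (hreal _ e).symm)

theorem weakThreeCube_isIdempotent : weakThreeCube.{d}.IsIdempotent := by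
  rintro _ ⟨⟩ B _ hB e
  refine Eq.trans (congrArg (FirstOrder.Language.Structure.funMap
    (L := weakThreeCube.signature) (n := 6) SixarySymbol.t) ?_) (hB _ (.inl rfl) e)
  ext k
  fin_cases k <;> rfl

theorem weakThreeCube_exists_term {L : FirstOrder.Language.{u, v}} {A : Type w} [L.Structure A]
    (h : weakThreeCube.{d}.SatisfiedBy L A) :
    ∃ t : L.Term (Fin 6), ∀ x y : A,
        t.realize ![x, y, y, y, x, x] = t.realize ![y, x, y, x, y, x] ∧
        t.realize ![y, x, y, x, y, x] = t.realize ![y, y, x, x, x, y] := by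
  obtain ⟨c, hc⟩ := h
  have hreal : ∀ (i : Fin 6 → ℕ) (e : ℕ → A), ((sixaryTerm.{d} i).substFunc c).realize e =
      (c SixarySymbol.t).realize fun k => e (i k) := fun i e => Term.realize_subst
  refine ⟨c SixarySymbol.t, fun x y => ?_⟩
  obtain ⟨e, rfl, rfl⟩ : ∃ e : ℕ → A, e 0 = x ∧ e 1 = y := ⟨fun k => if k = 0 then x else y, rfl, rfl⟩
  have h₁ := hc _ (.inr (.inl rfl)) e
  have h₂ := hc _ (.inr (.inr rfl)) e
  have h₁ := (hreal _ _).symm.trans (h₁.trans (hreal _ _))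
  have h₂ := (hreal _ _).symm.trans (h₂.trans (hreal _ _))
  rw [apply_vecSix, apply_vecSix] at h₁ h₂
  exact ⟨h₁, h₂⟩

theorem weakThreeCube_not_isTrivial :
    ¬ EquationalCondition.IsTrivial.{d, u, v, w} weakThreeCube.{d} := by
  intro h
  -- With no operations the only terms are variables, and none of the six variables satisfies the
  -- equations on two elements.
  let L : FirstOrder.Language.{u, v} := ⟨fun _ => PEmpty, fun _ => PEmpty⟩
  have : L.IsAlgebraic := fun _ => inferInstanceAs (IsEmpty PEmpty)
  let _ : L.Structure (ULift.{w} Bool) := { funMap := fun f _ => f.elim, RelMap := fun r _ => r.elim }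
  obtain ⟨t, ht⟩ := weakThreeCube_exists_term (h L (ULift.{w} Bool))
  have := ht ⟨true⟩ ⟨false⟩
  cases t with
  | func f _ => exact f.elim
  | var i => fin_cases i <;> simp [Term.realize_var] at this

theorem theorem1p1 :
    (∀ (L : FirstOrder.Language.{u, v}) [L.IsAlgebraic] (A : Type w) [L.Structure A],
      (∃ S : EquationalCondition.{d},
          ¬ EquationalCondition.IsTrivial.{d, u, v, w} S ∧ S.IsIdempotent ∧ S.SatisfiedBy L A) ↔
        ∃ t : L.Term (Fin 6),
          (∀ x : A, t.realize ![x, x, x, x, x, x] = x) ∧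
          ∀ x y : A,
            t.realize ![x, y, y, y, x, x] = t.realize ![y, x, y, x, y, x] ∧
            t.realize ![y, x, y, x, y, x] = t.realize ![y, y, x, x, x, y]) ∧
    (¬ EquationalCondition.IsTrivial.{d, u, v, w} weakThreeCube.{d} ∧
      weakThreeCube.{d}.IsIdempotent ∧
      ∀ S : EquationalCondition.{d},
        ¬ EquationalCondition.IsTrivial.{d, u, v, w} S → S.IsIdempotent →
          EquationalCondition.WeakerThan.{d, u, v, w} weakThreeCube.{d} S) := by
  refine ⟨fun L _ A _ => ⟨fun ⟨S, hS, hidem, h⟩ => h.exists_weakThreeCube_term hS hidem,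
    fun ⟨t, ht, ht'⟩ => ⟨weakThreeCube, weakThreeCube_not_isTrivial, weakThreeCube_isIdempotent,
      weakThreeCube_satisfiedBy t ht ht'⟩⟩,
    weakThreeCube_not_isTrivial, weakThreeCube_isIdempotent, fun S hS hidem L _ A _ h => ?_⟩
  obtain ⟨t, ht, ht'⟩ := h.exists_weakThreeCube_term hS hidem
  exact weakThreeCube_satisfiedBy t ht ht'
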